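/- Let $X$ be a real Banach space, $(\Xi,d_\Xi)$ a complete metric space, and $\{\theta_t:t\in\mathbb R\}$ a group of maps of $\Xi$ such that $(t,\sigma)\mapsto\theta_t\sigma$ is continuous. Let $g\in\Xi$ and let $\Sigma=\overline{\{\theta_t g:t\in\mathbb R\}}$ be its hull. Let $\{U_\sigma(t,s):t\ge s\}_{\sigma\in\Sigma}$ be a system of evolution processes in $X$: the maps $U_\sigma(t,s):X\to X$ are continuous, $U_\sigma(s,s)=\mathrm{Id}$, $U_\sigma(t,s)U_\sigma(s,r)=U_\sigma(t,r)$ for $t\ge s\ge r$, $(t,s)\mapsto U_\sigma(t,s)x$ is continuous on $\{t\ge s\}$ for each $x\in X$, and $U_{\theta_h\sigma}(t,s)=U_\sigma(t+h,s+h)$ for $t\ge s$, $h\in\mathbb R$. Let $\mathcal B\subset X$ be a closed, bounded, uniformly absorbing set: for every bounded $D\subset X$ there is $t_D\ge0$ with $U_\sigma(t,0)D\subset\mathcal B$ for all $t\ge t_D$, $\sigma\in\Sigma$. Assume: - $(H_1)$ There is a Banach space $Y$ compactly embedded in $X$. - $(H_2)$ For every $t>0$ there is $\kappa(t)$ such that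 $\sup_{\sigma\in\Sigma}\|U_\sigma(t,0)x-U_\sigma(t,0)y\|_Y\le\kappa(t)\|x-y\|_X$ for all $x,y\in\mathcal B$ (in particular these differences lie in $Y$). - $(H_3)$ There are exponents $\gamma,\delta>0$ and, for each $r\ge 0$, a constant $C(r)$ such that $\|U_\sigma(t+s,s)x-U_\sigma(\tilde t+s,s)y\|_X\le C(r)\,(\|x-y\|_X^\gamma+|t-\tilde t|^\delta)$ for all $\sigma\in\Sigma$, $s\in\mathbb R$, $t,\tilde t\in[0,r]$, $x,y\in\mathcal B$. - $(H_4)$ There are $P\ge1$, $\zeta>0$ such that $d_\Xi(\theta_t\xi_1,\theta_t\xi_2)\le Pe^{\zeta t}d_\Xi(\xi_1,\xi_2)$ for all $t\ge0$, $\xi_1,\xi_2\in\Xi$. - $(H_5)$ There are $c_1,\beta>0$ and a function $L$ with $1\le L(t)\le c_1e^{\beta t}$ for $t\ge1$ such that $\|U_{\sigma_1}(t,0)x-U_{\sigma_2}(t,0)x\|_X\le L(t)\,d_\Xi(\sigma_1,\sigma_2)$ for all $t\ge1$, $\sigma_1,\sigma_2\in\Sigma$, $x\in\mathcal B$. For a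 subset $K$ of a metric space, let $N(K,r)\in\mathbb N\cup\{\infty\}$ be the minimal number of open balls of radius $r$ needed to cover $K$, and let $d_B(K)=\limsup_{r\to0^+}\frac{\log N(K,r)}{-\log r}$ be its box-counting dimension. Suppose that there is a compact set $\Sigma_-\subset\Xi$ with $\theta_t\Sigma_-=\Sigma_-$ for all $t\in\mathbb R$ and $d_B(\Sigma_-)<\infty$, which contains the alpha limit set $\alpha(g)=\{\lim_n\theta_{t_n}g : t_n\to-\infty,\ \text{the limit exists}\}$, and that there are constants $\eta_1>0$, $C\ge1$ with $$\mathrm{dist}_\Xi(\theta_tg,\Sigma_-)\le Ce^{\eta_1t}\qquad\text{for all }t\in\mathbb R.$$ Then the process $\{U_g(t,s):t\ge s\}$ has a pullback attractor $\{A_g(t):t\in\mathbb R\}$, that is, a family of compact subsets of $X$ with bounded union such that $U_g(t,s)A_g(s)=A_g(t)$ for $t\ge s$ and, for every bounded $D\subset X$ and $t\in\mathbb R$, $\sup_{x\in D}\mathrm{dist}(U_g(t,s)x,A_g(t))\to0$ as $s\to-\infty$; and for every such family and every $T\in\mathbb R$, $$d_B\Big(\bigcup_{t\le T}A_g(t)\Big)<\infty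 .$$ -/

import Mathlib

open Set Filter Topology
open scoped ENNReal

noncomputable section

/-- Minimal number of open balls of radius `r` needed to cover `K` (`⊤` if no finite number
suffices). -/
def coveringNum {X : Type*} [PseudoMetricSpace X] (K : Set X) (r : ℝ) : ℕ∞ :=
  ⨅ (F : Finset X) (_ : K ⊆ ⋃ x ∈ F, Metric.ball x r), (F.card : ℕ∞)

/-- The (upper) box-counting dimension `limsup_{r → 0+} log N(K, r) / (- log r)`, as an extended
real number. -/
def boxDim {X : Type*} [PseudoMetricSpace X] (K : Set X) : EReal :=
  limsup (fun r : ℝ => ENNReal.log (coveringNum K r : ℝ≥0∞) / ((-Real.log r : ℝ) : EReal))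
    (𝓝[>] (0 : ℝ))

/-- The Hausdorff semi-distance `sup_{x ∈ A} dist (x, B)`. -/
def hausdorffSemiDist {X : Type*} [PseudoMetricSpace X] (A B : Set X) : ℝ≥0∞ :=
  ⨆ x ∈ A, Metric.infEDist x B

/-- `{U(t,s) : t ≥ s}` is an evolution process; `U t s` is only relevant for `s ≤ t`. -/
structure IsEvolutionProcess {X : Type*} [TopologicalSpace X] (U : ℝ → ℝ → X → X) : Prop where
  continuous_map : ∀ t s : ℝ, s ≤ t → Continuous (U t s)
  map_self : ∀ (s : ℝ) (x : X), U s s x = x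
  map_map : ∀ t s r : ℝ, r ≤ s → s ≤ t → ∀ x : X, U t s (U s r x) = U t r x
  continuous_time : ∀ x : X, ContinuousOn (fun p : ℝ × ℝ => U p.1 p.2 x) {p | p.2 ≤ p.1}

/-- `A` is the pullback attractor of the process `U`. -/
structure IsPullbackAttractor {X : Type*} [PseudoMetricSpace X] (U : ℝ → ℝ → X → X)
    (A : ℝ → Set X) : Prop where
  isCompact : ∀ t : ℝ, IsCompact (A t)
  isBounded : Bornology.IsBounded (⋃ t : ℝ, A t)
  invariant : ∀ t s : ℝ, s ≤ t → U t s '' A s = A t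
  attracts : ∀ (t : ℝ) (D : Set X), Bornology.IsBounded D →
    Tendsto (fun s : ℝ => hausdorffSemiDist (U t s '' D) (A t)) atBot (𝓝 0)

/-- The hull of `g`: the closure of its orbit under the driving group `θ`. -/
def hull {Ξ : Type*} [TopologicalSpace Ξ] (θ : Flow ℝ Ξ) (g : Ξ) : Set Ξ :=
  closure (range fun r : ℝ => θ r g)

/-- The alpha limit set of `g`. -/
def alphaLimitSet {Ξ : Type*} [TopologicalSpace Ξ] (θ : Flow ℝ Ξ) (g : Ξ) : Set Ξ :=
  {y | ∃ u : ℕ → ℝ, Tendsto u atTop atBot ∧ Tendsto (fun n => θ (u n) g) atTop (𝓝 y)}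

/-- `{U_σ(t,s) : t ≥ s}`, `σ ∈ S`, is a system of evolution processes with symbol space `S`;
`U σ` is only relevant for `σ ∈ S`. -/
structure IsProcessSystem {X Ξ : Type*} [TopologicalSpace X] [TopologicalSpace Ξ]
    (θ : Flow ℝ Ξ) (S : Set Ξ) (U : Ξ → ℝ → ℝ → X → X) : Prop where
  isEvolutionProcess : ∀ σ ∈ S, IsEvolutionProcess (U σ)
  translation : ∀ σ ∈ S, ∀ t s h : ℝ, s ≤ t → U (θ h σ) t s = U σ (t + h) (s + h)

/-- `B` is a uniformly absorbing set of the system. -/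
def IsUniformlyAbsorbing {X Ξ : Type*} [PseudoMetricSpace X]
    (S : Set Ξ) (U : Ξ → ℝ → ℝ → X → X) (B : Set X) : Prop :=
  ∀ D : Set X, Bornology.IsBounded D →
    ∃ tD : ℝ, 0 ≤ tD ∧ ∀ σ ∈ S, ∀ t : ℝ, tD ≤ t → ∀ x ∈ D, U σ t 0 x ∈ B

/-- The system is uniformly smoothing on `B` with respect to the space `Y`, embedded in `X` by
`ι`: the differences `U_σ(t,0)x - U_σ(t,0)y` lie in `Y`, with `Y`-norm at most `κ(t) ‖x - y‖`. -/
def IsUniformlySmoothing {X Y Ξ : Type*} [NormedAddCommGroup X] [NormedSpace ℝ X]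
    [NormedAddCommGroup Y] [NormedSpace ℝ Y] (ι : Y →L[ℝ] X)
    (S : Set Ξ) (U : Ξ → ℝ → ℝ → X → X) (B : Set X) : Prop :=
  ∀ t : ℝ, 0 < t → ∃ κ : ℝ, ∀ σ ∈ S, ∀ x ∈ B, ∀ y ∈ B,
    ∃ w : Y, ι w = U σ t 0 x - U σ t 0 y ∧ ‖w‖ ≤ κ * ‖x - y‖

/-- Hölder continuity in space and time on `B`, with exponents `γ` and `δ`, uniformly in the
symbol and in the initial time. -/
def IsHolderOn {X Ξ : Type*} [NormedAddCommGroup X]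
    (S : Set Ξ) (U : Ξ → ℝ → ℝ → X → X) (B : Set X) (γ δ : ℝ) : Prop :=
  ∀ r : ℝ, 0 ≤ r → ∃ C : ℝ, ∀ σ ∈ S, ∀ s : ℝ, ∀ x ∈ B, ∀ y ∈ B,
    ∀ t ∈ Icc 0 r, ∀ t' ∈ Icc 0 r,
      ‖U σ (t + s) s x - U σ (t' + s) s y‖ ≤ C * (‖x - y‖ ^ γ + |t - t'| ^ δ)

/-- The driving group is Lipschitz in forward time, with an exponentially bounded constant. -/
def IsLipschitzDriving {Ξ : Type*} [MetricSpace Ξ] (θ : Flow ℝ Ξ) : Prop :=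
  ∃ P ζ : ℝ, 1 ≤ P ∧ 0 < ζ ∧ ∀ t : ℝ, 0 ≤ t → ∀ ξ₁ ξ₂ : Ξ,
    dist (θ t ξ₁) (θ t ξ₂) ≤ P * Real.exp (ζ * t) * dist ξ₁ ξ₂

/-- The system is Lipschitz in the symbol on `B`, with an exponentially bounded constant. -/
def IsSymbolLipschitz {X Ξ : Type*} [NormedAddCommGroup X] [MetricSpace Ξ]
    (S : Set Ξ) (U : Ξ → ℝ → ℝ → X → X) (B : Set X) : Prop :=
  ∃ (L : ℝ → ℝ) (c₁ β : ℝ), 0 < c₁ ∧ 0 < β ∧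
    (∀ t : ℝ, 1 ≤ t → 1 ≤ L t ∧ L t ≤ c₁ * Real.exp (β * t)) ∧
    ∀ t : ℝ, 1 ≤ t → ∀ σ₁ ∈ S, ∀ σ₂ ∈ S, ∀ x ∈ B,
      ‖U σ₁ t 0 x - U σ₂ t 0 x‖ ≤ L t * dist σ₁ σ₂

end

/-!
The attractor exists because the smoothing property makes the time-one maps send `B` into compact
sets: the pullback omega-limits of `B` form an attractor
(`IsEvolutionProcess.exists_isPullbackAttractor`).

For the dimension it suffices to cover the union of the sections `A t`, `t ≤ T`, by `M ^ n` balls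
of radius `K * 2⁻ⁿ` for all large `n` (`boxDim_lt_top_of_coverableBy`). Fix a time `τ` after which
`B` is mapped into itself. By smoothing and compactness of the embedding, a time-`τ` map halves the
radius of a covering of a subset of `B` at the cost of a fixed factor `N` in the number of balls
(`exists_coverableBy_image_half`). Iterating, the image of `B` under the time-`n τ` map of *any*
symbol is covered by `N ^ n` balls of radius `R * 2⁻ⁿ`
(`IsProcessSystem.exists_coverableBy_image`). Every `A t` lies in such an image, for the symbol
`θ (t - n τ) g`, so each section separately has the right coverings, uniformly in `t`. It remains
to control the union over `t`, for which times are split at `-p n`.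

* For `t ≤ -p n`, with `p` large, the symbol `θ (t - n τ) g` is so close to `Sm` that, `Sm` having
  finite box dimension, geometrically many symbols of the orbit approximate all of them up to an
  error of order `q ^ n`. With `q = exp (-β τ) / 2` the Lipschitz dependence on the symbol turns
  this into an error of order `2⁻ⁿ` in `X`: `IsPullbackAttractor.exists_coverableBy_past`.
* The interval from `-p n` to `T` consists of linearly many unit windows. Over each of them Hölder
  continuity in space and time extends the covering of one section to the whole window:
  `IsPullbackAttractor.exists_coverableBy_Icc`.

The two parts are put together in `boxDim_iUnion_Iic_lt_top`.
-/

/-! ### Coverings by finitely many balls -/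

/-- `S` can be covered by at most `N` open balls of radius `r`; the centers need not lie in `S`. -/
def CoverableBy {X : Type*} [PseudoMetricSpace X] (S : Set X) (r : ℝ) (N : ℕ) : Prop :=
  ∃ F : Finset X, (∀ x ∈ S, ∃ y ∈ F, dist x y < r) ∧ F.card ≤ N

namespace CoverableBy

variable {X : Type*} [PseudoMetricSpace X] {S S' : Set X} {r r' : ℝ} {N N' : ℕ}

lemma mono (h : CoverableBy S r N) (hS : S' ⊆ S) (hr : r ≤ r') (hN : N ≤ N') :
    CoverableBy S' r' N' := by
  obtain ⟨F, hF, hc⟩ := h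
  refine ⟨F, fun x hx => ?_, hc.trans hN⟩
  obtain ⟨y, hy, hxy⟩ := hF x (hS hx)
  exact ⟨y, hy, hxy.trans_le hr⟩

lemma biUnion {ι : Type*} (I : Finset ι) {S : ι → Set X}
    (h : ∀ i ∈ I, CoverableBy (S i) r N) : CoverableBy (⋃ i ∈ I, S i) r (I.card * N) := by
  classical
  choose! F hF hc using h
  refine ⟨I.biUnion F, fun x hx => ?_, Finset.card_biUnion_le_card_mul _ _ _ hc⟩
  obtain ⟨i, hi, hxi⟩ := mem_iUnion₂.1 hx
  obtain ⟨y, hy, hxy⟩ := hF i hi x hxi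
  exact ⟨y, Finset.mem_biUnion.2 ⟨i, hi, hy⟩, hxy⟩

lemma union (h : CoverableBy S r N) (h' : CoverableBy S' r N') :
    CoverableBy (S ∪ S') r (N + N') := by
  classical
  obtain ⟨F, hF, hc⟩ := h
  obtain ⟨F', hF', hc'⟩ := h'
  refine ⟨F ∪ F', ?_, (Finset.card_union_le _ _).trans (add_le_add hc hc')⟩
  rintro x (hx | hx)
  · obtain ⟨y, hy, hxy⟩ := hF x hx
    exact ⟨y, Finset.mem_union_left _ hy, hxy⟩
  · obtain ⟨y, hy, hxy⟩ := hF' x hx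
    exact ⟨y, Finset.mem_union_right _ hy, hxy⟩

/-- At the price of doubling the radius, the centers may be taken in the covered set. -/
lemma exists_centers_mem (h : CoverableBy S r N) :
    ∃ F : Finset X, (∀ y ∈ F, y ∈ S) ∧ (∀ x ∈ S, ∃ y ∈ F, dist x y < 2 * r) ∧ F.card ≤ N := by
  classical
  obtain ⟨F, hF, hc⟩ := h
  have key : ∀ y ∈ F.filter (fun y => ∃ x ∈ S, dist x y < r), ∃ x, x ∈ S ∧ dist x y < r := by
    intro y hy
    exact (Finset.mem_filter.1 hy).2
  choose! c hcS hcd using key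
  refine ⟨(F.filter (fun y => ∃ x ∈ S, dist x y < r)).image c, ?_, fun x hx => ?_,
    Finset.card_image_le.trans ((Finset.card_filter_le _ _).trans hc)⟩
  · intro z hz
    obtain ⟨y, hy, rfl⟩ := Finset.mem_image.1 hz
    exact hcS y hy
  · obtain ⟨y, hy, hxy⟩ := hF x hx
    have hy' : y ∈ F.filter (fun y => ∃ x ∈ S, dist x y < r) :=
      Finset.mem_filter.2 ⟨hy, x, hx, hxy⟩
    refine ⟨c y, Finset.mem_image_of_mem _ hy', ?_⟩
    have := dist_triangle_right x (c y) y
    linarith [hcd y hy']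

lemma thickening {d : ℝ} (h : CoverableBy S r N) (hS : ∀ x ∈ S', ∃ y ∈ S, dist x y ≤ d) :
    CoverableBy S' (r + d) N := by
  obtain ⟨F, hF, hc⟩ := h
  refine ⟨F, fun x hx => ?_, hc⟩
  obtain ⟨y, hy, hxy⟩ := hS x hx
  obtain ⟨z, hz, hyz⟩ := hF y hy
  exact ⟨z, hz, by linarith [dist_triangle x y z]⟩

lemma coveringNum_le (h : CoverableBy S r N) : coveringNum S r ≤ N := by
  obtain ⟨F, hF, hc⟩ := h
  refine (iInf₂_le F fun x hx => ?_).trans (by exact_mod_cast hc)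
  obtain ⟨y, hy, hxy⟩ := hF x hx
  exact mem_iUnion₂.2 ⟨y, hy, hxy⟩

lemma of_coveringNum_lt (h : coveringNum S r < N) : CoverableBy S r N := by
  obtain ⟨F, hF⟩ := iInf_lt_iff.1 h
  obtain ⟨hS, hF⟩ := iInf_lt_iff.1 hF
  refine ⟨F, fun x hx => ?_, by exact_mod_cast hF.le⟩
  obtain ⟨y, hy, hxy⟩ := mem_iUnion₂.1 (hS hx)
  exact ⟨y, hy, hxy⟩

end CoverableBy

/-! ### Finite box-counting dimension -/

/-- A set which for all large `n` is covered by `M ^ n` balls of radius `K * 2⁻ⁿ` has finite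
box-counting dimension. -/
lemma boxDim_lt_top_of_coverableBy {X : Type*} [PseudoMetricSpace X] {S : Set X} {K : ℝ} {M : ℕ}
    (hK : 0 < K) (h : ∀ᶠ n : ℕ in atTop, CoverableBy S (K * (1 / 2) ^ n) (M ^ n)) :
    boxDim S < ⊤ := by
  set M' : ℕ := M + 1
  have hM' : (1 : ℝ) ≤ M' := by simp [M']
  have hlogM : 0 ≤ Real.log M' := Real.log_nonneg hM'
  -- At radius `r`, the covering with `n = ⌈4 (-log r)⌉` is fine enough because `1 / 2 ≤ log 2`.
  have hlog : Tendsto (fun r : ℝ => -Real.log r) (𝓝[>] 0) atTop :=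
    tendsto_neg_atBot_atTop.comp Real.tendsto_log_nhdsGT_zero
  have hn : Tendsto (fun r : ℝ => ⌈4 * -Real.log r⌉₊) (𝓝[>] 0) atTop :=
    tendsto_nat_ceil_atTop.comp (hlog.const_mul_atTop (by norm_num))
  have hle : boxDim S ≤ ((5 * Real.log M' : ℝ) : EReal) := by
    refine limsup_le_of_le (by isBoundedDefault) ?_
    filter_upwards [hn.eventually h, hlog.eventually_ge_atTop 1,
      hlog.eventually_ge_atTop (Real.log K), self_mem_nhdsWithin] with r hr h1 hKr hr0
    have hr0 : 0 < r := hr0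
    set l := -Real.log r with hl
    set n := ⌈4 * l⌉₊
    have hn1 : 4 * l ≤ n := Nat.le_ceil _
    have hn2 : (n : ℝ) < 4 * l + 1 := Nat.ceil_lt_add_one (by linarith)
    have hrad : K * (1 / 2) ^ n ≤ r := by
      rw [← Real.log_le_log_iff (by positivity) hr0, Real.log_mul hK.ne' (by positivity),
        Real.log_pow, one_div, Real.log_inv]
      have : (1 : ℝ) / 2 ≤ Real.log 2 := by linarith [Real.log_two_gt_d9]
      nlinarith [mul_le_mul hn1 this (by norm_num) (by positivity)]
    have hcov : CoverableBy S r (M' ^ n) :=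
      hr.mono Subset.rfl hrad (Nat.pow_le_pow_left (Nat.le_succ M) n)
    rw [EReal.div_le_iff_le_mul (by exact_mod_cast (by linarith : (0 : ℝ) < l))
      (EReal.coe_ne_top _)]
    have hlogN : ENNReal.log (coveringNum S r : ℝ≥0∞) ≤
        ENNReal.log (ENNReal.ofReal ((M' : ℝ) ^ n)) := by
      refine ENNReal.log_monotone ?_
      rw [ENNReal.ofReal_pow (by positivity), ENNReal.ofReal_natCast]
      exact_mod_cast ENat.toENNReal_mono hcov.coveringNum_le
    refine hlogN.trans ?_
    rw [ENNReal.log_ofReal_of_pos (by positivity), Real.log_pow, ← EReal.coe_mul]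
    refine EReal.coe_le_coe_iff.2 ?_
    nlinarith
  exact hle.trans_lt (EReal.coe_lt_top _)

/-- A set of finite box-counting dimension has, along every geometric scale `q ^ n`, coverings of
geometric cardinality. -/
lemma exists_coverableBy_of_boxDim_lt_top {X : Type*} [PseudoMetricSpace X] {S : Set X}
    (h : boxDim S < ⊤) {q : ℝ} (hq0 : 0 < q) (hq1 : q < 1) :
    ∃ M : ℕ, ∀ᶠ n : ℕ in atTop, CoverableBy S (q ^ n) (M ^ n) := by
  obtain ⟨D, hD, -⟩ := EReal.exists_between_coe_real h
  have hev := eventually_lt_of_limsup_lt hD (by isBoundedDefault)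
  have hq : Tendsto (fun n : ℕ => q ^ n) atTop (𝓝[>] 0) :=
    tendsto_nhdsWithin_iff.2 ⟨tendsto_pow_atTop_nhds_zero_of_lt_one hq0.le hq1,
      Eventually.of_forall fun n => pow_pos hq0 n⟩
  obtain ⟨M, hM⟩ := exists_nat_gt (Real.exp (D * -Real.log q))
  refine ⟨M, ?_⟩
  filter_upwards [hq.eventually hev, eventually_ge_atTop 1] with n hn hn1
  have hlq : 0 < -Real.log q := neg_pos.2 (Real.log_neg hq0 hq1)
  have hn1' : (1 : ℝ) ≤ n := by exact_mod_cast hn1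
  have hl : -Real.log (q ^ n) = n * -Real.log q := by rw [Real.log_pow]; ring
  rw [hl, EReal.div_lt_iff (by exact_mod_cast (by positivity)) (EReal.coe_ne_top _),
    ← EReal.coe_mul, ← Real.log_exp (D * (n * -Real.log q)),
    ← ENNReal.log_ofReal_of_pos (Real.exp_pos _), ENNReal.log_lt_log_iff] at hn
  apply CoverableBy.of_coveringNum_lt
  have : ENNReal.ofReal (Real.exp (D * (n * -Real.log q))) ≤ ((M ^ n : ℕ) : ℝ≥0∞) := by
    rw [← ENNReal.ofReal_natCast]
    refine ENNReal.ofReal_le_ofReal ?_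
    rw [show D * (n * -Real.log q) = n * (D * -Real.log q) by ring, Real.exp_nat_mul]
    push_cast
    exact pow_le_pow_left₀ (Real.exp_pos _).le hM.le n
  have h2 := hn.trans_le this
  exact_mod_cast h2

/-! ### Existence of the pullback attractor -/

/-- A process with a closed bounded set `B` absorbing bounded sets in a uniform time, and whose
time-one maps send `B` into compact sets, has a pullback attractor: the family of pullback
omega-limits of `B`. -/
theorem IsEvolutionProcess.exists_isPullbackAttractor {X : Type*} [MetricSpace X]
    {V : ℝ → ℝ → X → X} (hV : IsEvolutionProcess V) {B : Set X} (hB_closed : IsClosed B)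
    (hB_bdd : Bornology.IsBounded B)
    (habs : ∀ D : Set X, Bornology.IsBounded D →
      ∃ tD : ℝ, ∀ t s : ℝ, s ≤ t - tD → MapsTo (V t s) D B)
    (hcomp : ∀ t : ℝ, ∃ K : Set X, IsCompact K ∧ MapsTo (V t (t - 1)) B K) :
    ∃ A : ℝ → Set X, IsPullbackAttractor V A := by
  choose K hK hVK using hcomp
  obtain ⟨tB, htB⟩ := habs B hB_bdd
  have hBB : ∀ t : ℝ, ∀ᶠ s in atBot, MapsTo (V t s) B B := fun t => by
    filter_upwards [eventually_le_atBot (t - tB)] with s hs using htB t s hs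
  have hBK : ∀ t : ℝ, ∀ᶠ s in atBot, MapsTo (V t s) B (K t) := fun t => by
    filter_upwards [eventually_le_atBot (t - 1), hBB (t - 1)] with s hs hsB x hx
    rw [← hV.map_map t (t - 1) s hs (by linarith)]
    exact hVK t (hsB hx)
  have hsub : ∀ (t : ℝ) (S : Set X), IsClosed S → (∀ᶠ s in atBot, MapsTo (V t s) B S) →
      omegaLimit atBot (V t) B ⊆ S := by
    intro t S hS h
    refine (omegaLimit_subset_closure_image2 _ _ _ h).trans (closure_minimal ?_ hS)
    rintro _ ⟨s, hs, x, hx, rfl⟩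
    exact hs hx
  -- Any neighbourhood of the omega-limit contains the images of `B` from the distant past.
  have hnhds : ∀ (t : ℝ) (O : Set X), IsOpen O → omegaLimit atBot (V t) B ⊆ O →
      ∀ᶠ s in atBot, MapsTo (V t s) B O := fun t O hO h =>
    eventually_mapsTo_of_isCompact_absorbing_of_isOpen_of_omegaLimit_subset _ _ _ (hK t) (hBK t)
      hO h
  have hcpt : ∀ t, IsCompact (omegaLimit atBot (V t) B) := fun t =>
    (hK t).of_isClosed_subset (isClosed_omegaLimit _ _ _) (hsub t _ (hK t).isClosed (hBK t))
  refine ⟨fun t => omegaLimit atBot (V t) B, hcpt,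
    hB_bdd.subset (iUnion_subset fun t => hsub t B hB_closed (hBB t)), ?_, ?_⟩
  · intro t s hst
    apply Subset.antisymm
    · rintro _ ⟨z, hz, rfl⟩
      rw [mem_omegaLimit_iff_frequently] at hz ⊢
      intro O hO
      refine ((hz _ ((hV.continuous_map t s hst).continuousAt hO)).and_eventually
        (eventually_le_atBot s)).mono ?_
      rintro r ⟨⟨x, hx, hxO⟩, hr⟩
      refine ⟨x, hx, ?_⟩
      rw [mem_preimage, ← hV.map_map t s r hr hst]
      exact hxO
    · intro y hy
      by_contra hyn
      obtain ⟨c, hc, hc_closed, hcs⟩ := exists_mem_nhds_isClosed_subset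
        (((hcpt s).image (hV.continuous_map t s hst)).isClosed.isOpen_compl.mem_nhds hyn)
      have hev := hnhds s _ (hc_closed.isOpen_compl.preimage (hV.continuous_map t s hst))
        fun z hz hzc => hcs hzc (mem_image_of_mem _ hz)
      obtain ⟨r, ⟨⟨x, hx, hxc⟩, hr⟩, hrs⟩ :=
        (((mem_omegaLimit_iff_frequently _ _ _ _).1 hy c hc).and_eventually hev).and_eventually
          (eventually_le_atBot s) |>.exists
      refine hr hx ?_
      rw [hV.map_map t s r hrs hst]
      exact hxc
  · intro t D hD
    rw [ENNReal.tendsto_nhds_zero]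
    intro ε hε
    obtain ⟨r, hr, hrt⟩ := ((hnhds t {x | Metric.infEDist x (omegaLimit atBot (V t) B) < ε}
      (isOpen_lt Metric.continuous_infEDist continuous_const)
      fun x hx => by simpa [Metric.infEDist_zero_of_mem hx] using hε).and
      (eventually_le_atBot t)).exists
    obtain ⟨tD, htD⟩ := habs D hD
    filter_upwards [eventually_le_atBot (r - tD), eventually_le_atBot r] with s hs hsr
    refine iSup₂_le ?_
    rintro _ ⟨x, hx, rfl⟩
    rw [← hV.map_map t r s hsr hrt]
    exact (hr (htD r s hs hx)).le

/-! ### Translation along the hull -/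

lemma orbit_mem_hull {Ξ : Type*} [TopologicalSpace Ξ] (θ : Flow ℝ Ξ) (g : Ξ) (t : ℝ) :
    θ t g ∈ hull θ g :=
  subset_closure (mem_range_self t)

lemma flow_mem_hull {Ξ : Type*} [TopologicalSpace Ξ] {θ : Flow ℝ Ξ} {g : Ξ} {σ : Ξ}
    (hσ : σ ∈ hull θ g) (t : ℝ) : θ t σ ∈ hull θ g := by
  refine map_mem_closure (θ.continuous_toFun t) hσ ?_
  rintro _ ⟨s, rfl⟩
  exact ⟨t + s, θ.map_add t s g⟩

lemma self_mem_hull {Ξ : Type*} [TopologicalSpace Ξ] (θ : Flow ℝ Ξ) (g : Ξ) : g ∈ hull θ g := by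
  simpa using orbit_mem_hull θ g 0

/-- The cocycle form of a process: starting at time `s` amounts to translating the symbol by
`s`. -/
lemma IsProcessSystem.eq_translate {X Ξ : Type*} [TopologicalSpace X] [TopologicalSpace Ξ]
    {θ : Flow ℝ Ξ} {g : Ξ} {U : Ξ → ℝ → ℝ → X → X} (hU : IsProcessSystem θ (hull θ g) U) {σ : Ξ}
    (hσ : σ ∈ hull θ g) {t s : ℝ} (hst : s ≤ t) : U σ t s = U (θ s σ) (t - s) 0 := by
  rw [hU.translation σ hσ (t - s) 0 s (by linarith), sub_add_cancel, zero_add]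

/-! ### Coverings produced by the smoothing property -/

/-- A map whose differences on `S` are Lipschitz into a compactly embedded space halves the
radius of coverings of `S`, while multiplying their cardinality by a constant which depends only
on the embedding and the Lipschitz constant. -/
lemma exists_coverableBy_image_half {X Y : Type*} [NormedAddCommGroup X] [NormedSpace ℝ X]
    [NormedAddCommGroup Y] [NormedSpace ℝ Y] {ι : Y →L[ℝ] X} (hι : IsCompactOperator ι) (κ : ℝ) :
    ∃ N : ℕ, ∀ (f : X → X) (S : Set X) (r : ℝ) (M : ℕ),
      (∀ x ∈ S, ∀ y ∈ S, ∃ w : Y, ι w = f x - f y ∧ ‖w‖ ≤ κ * ‖x - y‖) →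
      CoverableBy S r M → CoverableBy (f '' S) (r * (1 / 2)) (M * N) := by
  classical
  set k : ℝ := max κ 1
  have hk : 0 < k := lt_max_of_lt_right one_pos
  have htb : TotallyBounded (ι '' Metric.closedBall 0 1) :=
    (IsCompactOperator.isCompact_closure_image_closedBall (f := ι.toLinearMap) hι
      1).totallyBounded.subset subset_closure
  obtain ⟨G, hG, hGc⟩ := Metric.totallyBounded_iff.1 htb (1 / (4 * k)) (by positivity)
  lift G to Finset X using hG
  refine ⟨G.card, fun f S r M hf hS => ?_⟩
  obtain ⟨F, hFS, hF, hFc⟩ := hS.exists_centers_mem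
  refine ⟨(F ×ˢ G).image fun p => f p.1 + (2 * k * r) • p.2, ?_,
    Finset.card_image_le.trans ?_⟩
  · rintro _ ⟨x, hx, rfl⟩
    obtain ⟨y, hy, hxy⟩ := hF x hx
    have hr : 0 < r := by linarith [dist_nonneg (x := x) (y := y)]
    obtain ⟨w, hw, hwn⟩ := hf x hx y (hFS y hy)
    have ha : 0 < 2 * k * r := by positivity
    have hu : (2 * k * r)⁻¹ • w ∈ Metric.closedBall (0 : Y) 1 := by
      rw [mem_closedBall_zero_iff, norm_smul, norm_inv, Real.norm_of_nonneg ha.le,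
        inv_mul_le_iff₀ ha, mul_one]
      rw [dist_eq_norm] at hxy
      calc ‖w‖ ≤ κ * ‖x - y‖ := hwn
        _ ≤ k * (2 * r) := mul_le_mul (le_max_left _ _) hxy.le (norm_nonneg _) hk.le
        _ = 2 * k * r := by ring
    obtain ⟨c, hc, huc⟩ := mem_iUnion₂.1 (hGc (mem_image_of_mem ι hu))
    refine ⟨_, Finset.mem_image_of_mem _ (Finset.mem_product.2 ⟨hy, hc⟩ : (y, c) ∈ F ×ˢ G), ?_⟩
    have hfx : f x - (f y + (2 * k * r) • c) =
        (2 * k * r) • (ι ((2 * k * r)⁻¹ • w) - c) := by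
      rw [map_smul, smul_sub, smul_inv_smul₀ ha.ne', hw]
      abel
    rw [mem_ball_iff_norm] at huc
    rw [dist_eq_norm, hfx, norm_smul, Real.norm_of_nonneg ha.le]
    calc 2 * k * r * ‖ι ((2 * k * r)⁻¹ • w) - c‖ < 2 * k * r * (1 / (4 * k)) :=
          mul_lt_mul_of_pos_left huc ha
      _ = r * (1 / 2) := by field_simp; norm_num
  · rw [Finset.card_product]
    exact Nat.mul_le_mul_right _ hFc

section Attractor

variable {X Ξ : Type*} [NormedAddCommGroup X] [MetricSpace Ξ]
  {θ : Flow ℝ Ξ} {g : Ξ} {U : Ξ → ℝ → ℝ → X → X} {B : Set X} {A : ℝ → Set X}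

/-- Iterating the smoothing property along the cocycle: if `B` is smoothed and mapped into itself
by all time-`τ` maps, then its images at time `n τ` are covered by `N ^ n` balls of radius
`R * 2⁻ⁿ`, uniformly in the symbol. -/
lemma IsProcessSystem.exists_coverableBy_image {Y : Type*} [NormedSpace ℝ X]
    [NormedAddCommGroup Y] [NormedSpace ℝ Y] (hU : IsProcessSystem θ (hull θ g) U)
    (hB_bdd : Bornology.IsBounded B) {ι : Y →L[ℝ] X} (hι : IsCompactOperator ι)
    (hsmooth : IsUniformlySmoothing ι (hull θ g) U B) {τ : ℝ} (hτ : 0 < τ)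
    (hmaps : ∀ σ ∈ hull θ g, ∀ t, τ ≤ t → MapsTo (U σ t 0) B B) :
    ∃ (R : ℝ) (N : ℕ), 0 < R ∧ ∀ σ ∈ hull θ g, ∀ n : ℕ,
      CoverableBy (U σ (n * τ) 0 '' B) (R * (1 / 2) ^ n) (N ^ n) := by
  obtain ⟨κ, hκ⟩ := hsmooth τ hτ
  obtain ⟨N, hN⟩ := exists_coverableBy_image_half hι κ
  obtain ⟨R, hR0, hR⟩ := hB_bdd.subset_ball_lt 0 0
  refine ⟨R, N, hR0, fun σ hσ n => ?_⟩
  have hP := hU.isEvolutionProcess σ hσ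
  induction n with
  | zero =>
    refine ⟨{0}, ?_, by simp⟩
    rintro _ ⟨x, hx, rfl⟩
    refine ⟨0, Finset.mem_singleton_self _, ?_⟩
    simpa [hP.map_self] using hR hx
  | succ n ih =>
    have hn : (0 : ℝ) ≤ n * τ := by positivity
    have hsubB : U σ (n * τ) 0 '' B ⊆ B := by
      rintro _ ⟨x, hx, rfl⟩
      rcases Nat.eq_zero_or_pos n with rfl | hpos
      · simpa [hP.map_self] using hx
      · refine hmaps σ hσ _ ?_ hx
        have : (1 : ℝ) ≤ n := by exact_mod_cast hpos
        nlinarith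
    have h := hN (U (θ (n * τ) σ) τ 0) _ _ _
      (fun x hx y hy => hκ _ (flow_mem_hull hσ _) x (hsubB hx) y (hsubB hy)) ih
    refine h.mono ?_ (by rw [pow_succ]; linarith) (by rw [pow_succ])
    rintro _ ⟨x, hx, rfl⟩
    refine ⟨_, mem_image_of_mem _ hx, ?_⟩
    rw [hU.translation σ hσ τ 0 _ hτ.le, zero_add, hP.map_map _ _ _ hn (by linarith)]
    congr 1
    push_cast
    ring

/-! ### Coverings of the attractor -/

lemma exists_dyadic_near {u : ℝ} (h0 : 0 ≤ u) (h1 : u ≤ 1) (m : ℕ) :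
    ∃ j ∈ Finset.range (2 ^ m), (j : ℝ) / 2 ^ m ∈ Icc (0 : ℝ) 1 ∧
      |u - (j : ℝ) / 2 ^ m| ≤ (1 / 2) ^ m := by
  have h2 : (0 : ℝ) < 2 ^ m := by positivity
  have hceil : ⌈u * 2 ^ m⌉₊ ≤ 2 ^ m := by
    refine Nat.ceil_le.2 ?_
    push_cast
    nlinarith
  have hj : ⌈u * 2 ^ m⌉₊ - 1 < 2 ^ m := by
    have := Nat.two_pow_pos m
    omega
  have hj' : ((⌈u * 2 ^ m⌉₊ - 1 : ℕ) : ℝ) ≤ 2 ^ m := by exact_mod_cast hj.le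
  refine ⟨⌈u * 2 ^ m⌉₊ - 1, Finset.mem_range.2 hj, ⟨by positivity, (div_le_one h2).2 hj'⟩, ?_⟩
  rw [show u - ((⌈u * 2 ^ m⌉₊ - 1 : ℕ) : ℝ) / 2 ^ m =
    (u * 2 ^ m - ((⌈u * 2 ^ m⌉₊ - 1 : ℕ) : ℝ)) / 2 ^ m by field_simp, abs_div, abs_of_pos h2,
    one_div, inv_pow, div_le_iff₀ h2, inv_mul_cancel₀ h2.ne', abs_le]
  have hle := Nat.le_ceil (u * 2 ^ m)
  have hlt := Nat.ceil_lt_add_one (mul_nonneg h0 h2.le)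
  rcases Nat.eq_zero_or_pos ⌈u * 2 ^ m⌉₊ with h | h
  · rw [h] at hle ⊢
    norm_num at hle ⊢
    constructor <;> nlinarith
  · rw [Nat.cast_sub h]
    push_cast
    constructor <;> linarith

lemma IsProcessSystem.exists_mapsTo (hU : IsProcessSystem θ (hull θ g) U)
    (hB_abs : IsUniformlyAbsorbing (hull θ g) U B) (D : Set X) (hD : Bornology.IsBounded D) :
    ∃ tD : ℝ, 0 ≤ tD ∧ ∀ t s : ℝ, s ≤ t - tD → MapsTo (U g t s) D B := by
  obtain ⟨tD, h0, h⟩ := hB_abs D hD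
  refine ⟨tD, h0, fun t s hs x hx => ?_⟩
  rw [hU.eq_translate (self_mem_hull θ g) (by linarith)]
  exact h _ (orbit_mem_hull θ g s) _ (by linarith) x hx

lemma IsPullbackAttractor.subset_absorbing (hA : IsPullbackAttractor (U g) A)
    (hU : IsProcessSystem θ (hull θ g) U) (hB_abs : IsUniformlyAbsorbing (hull θ g) U B) (t : ℝ) :
    A t ⊆ B := by
  obtain ⟨tD, h0, h⟩ := hU.exists_mapsTo hB_abs _ hA.isBounded
  rw [← hA.invariant t (t - tD) (by linarith)]
  rintro _ ⟨x, hx, rfl⟩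
  exact h t _ le_rfl (mem_iUnion_of_mem _ hx)

/-- A point of a section is the image of a point of `B` under a time-`h` map, for every `h ≥ 0`. -/
lemma IsPullbackAttractor.exists_eq (hA : IsPullbackAttractor (U g) A)
    (hU : IsProcessSystem θ (hull θ g) U) (hAB : ∀ t, A t ⊆ B) {t h : ℝ} (hh : 0 ≤ h) {x : X}
    (hx : x ∈ A t) : ∃ b ∈ B, U (θ (t - h) g) h 0 b = x := by
  rw [← hA.invariant t (t - h) (by linarith),
    hU.eq_translate (self_mem_hull θ g) (by linarith), sub_sub_cancel] at hx
  obtain ⟨b, hb, rfl⟩ := hx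
  exact ⟨b, hAB _ hb, rfl⟩

/-- Far past: for `t ≤ -p n` the symbol driving the time-`n τ` map which ends in `A t` is so close
to `Sm` that it may be replaced by one of finitely many symbols of the orbit of `g`, at most
geometrically many in `n`. -/
lemma IsPullbackAttractor.exists_coverableBy_past (hA : IsPullbackAttractor (U g) A)
    (hU : IsProcessSystem θ (hull θ g) U) (hAB : ∀ t, A t ⊆ B) {τ R : ℝ} {N : ℕ} (hτ : 1 ≤ τ)
    (hR : 0 < R)
    (hcov : ∀ σ ∈ hull θ g, ∀ n : ℕ,
      CoverableBy (U σ (n * τ) 0 '' B) (R * (1 / 2) ^ n) (N ^ n))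
    (hsymbol : IsSymbolLipschitz (hull θ g) U B) {Sm : Set Ξ} (hSm_dim : boxDim Sm < ⊤)
    {C η : ℝ} (hC : 1 ≤ C) (hη : 0 < η)
    (hSm : ∀ t : ℝ, Metric.infEDist (θ t g) Sm ≤ ENNReal.ofReal (C * Real.exp (η * t))) :
    ∃ (K : ℝ) (M p : ℕ), 0 < K ∧ ∀ᶠ n : ℕ in atTop,
      CoverableBy (⋃ t ∈ Iic (-(p * n : ℝ)), A t) (K * (1 / 2) ^ n) (M ^ n) := by
  obtain ⟨L, c, β, hc, hβ, hL, hUL⟩ := hsymbol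
  -- At time `n τ` a symbol error `q ^ n` grows to at most `c * 2⁻ⁿ`.
  set q : ℝ := Real.exp (-(β * τ)) * (1 / 2) with hq
  have hq0 : 0 < q := by positivity
  have hβτ : 0 < β * τ := by positivity
  have hq1 : q < 1 := by
    have : Real.exp (-(β * τ)) ≤ 1 := Real.exp_le_one_iff.2 (by linarith)
    linarith
  obtain ⟨M, hM⟩ := exists_coverableBy_of_boxDim_lt_top hSm_dim hq0 hq1
  -- Choice of `p`: by time `-p n` the orbit of `g` is within `q ^ n` of `Sm`.
  obtain ⟨p, hp⟩ : ∃ p : ℕ, C * Real.exp (-(η * p)) ≤ q := by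
    have h1 : Tendsto (fun p : ℕ => C * Real.exp (-(η * p))) atTop (𝓝 (C * 0)) :=
      (Real.tendsto_exp_neg_atTop_nhds_zero.comp
        (tendsto_natCast_atTop_atTop.const_mul_atTop hη)).const_mul C
    rw [mul_zero] at h1
    exact (h1.eventually_le_const hq0).exists
  refine ⟨R + 6 * c, M * N, p, by positivity, ?_⟩
  filter_upwards [hM, eventually_ge_atTop 1] with n hn hn1
  have hn1' : (1 : ℝ) ≤ n := by exact_mod_cast hn1
  have hqn : 0 < q ^ n := pow_pos hq0 n
  have hfar : ∀ t ∈ Iic (-(p * n : ℝ)), C * Real.exp (η * t) ≤ q ^ n := by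
    intro t ht
    have ht : t ≤ -(p * n : ℝ) := ht
    calc C * Real.exp (η * t) ≤ C ^ n * Real.exp (n * -(η * p)) := by
          refine mul_le_mul (le_self_pow₀ hC (by omega)) (Real.exp_le_exp.2 ?_)
            (Real.exp_pos _).le (by positivity)
          nlinarith [mul_le_mul_of_nonneg_left ht hη.le]
      _ = (C * Real.exp (-(η * p))) ^ n := by rw [Real.exp_nat_mul, mul_pow]
      _ ≤ q ^ n := pow_le_pow_left₀ (by positivity) hp n
  have horb : CoverableBy ((fun t => θ t g) '' Iic (-(p * n : ℝ))) (q ^ n + 2 * q ^ n) (M ^ n) := by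
    refine hn.thickening ?_
    rintro _ ⟨t, ht, rfl⟩
    have hlt : Metric.infEDist (θ t g) Sm < ENNReal.ofReal (2 * q ^ n) :=
      (hSm t).trans_lt ((ENNReal.ofReal_lt_ofReal_iff (by positivity)).2
        (by linarith [hfar t ht]))
    obtain ⟨y, hy, hty⟩ := Metric.infEDist_lt_iff.1 hlt
    exact ⟨y, hy, (edist_lt_ofReal.1 hty).le⟩
  -- The symbols of `Sm` need not lie in the hull, where alone the processes are controlled, so the
  -- centers are moved to the orbit of `g`; the radius becomes `2 * (3 * q ^ n) = 6 * q ^ n`.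
  obtain ⟨F, hFo, hF, hFc⟩ := horb.exists_centers_mem
  have hFh : ∀ σ ∈ F, σ ∈ hull θ g := by
    intro σ hσ
    obtain ⟨t, -, rfl⟩ := hFo σ hσ
    exact orbit_mem_hull θ g t
  have hunion := CoverableBy.biUnion F fun σ hσ => hcov σ (hFh σ hσ) n
  have hnτ : 1 ≤ n * τ := by nlinarith
  have hgrow : L (n * τ) * (6 * q ^ n) ≤ 6 * c * (1 / 2) ^ n := by
    calc L (n * τ) * (6 * q ^ n) ≤ c * Real.exp (β * (n * τ)) * (6 * q ^ n) := by
          gcongr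
          exact (hL _ hnτ).2
      _ = 6 * c * (1 / 2) ^ n * (Real.exp (β * (n * τ)) * Real.exp (n * -(β * τ))) := by
          rw [hq, mul_pow, Real.exp_nat_mul (-(β * τ)) n]; ring
      _ = 6 * c * (1 / 2) ^ n := by
          rw [← Real.exp_add, show β * (n * τ) + n * -(β * τ) = 0 by ring, Real.exp_zero, mul_one]
  refine (hunion.thickening (d := 6 * c * (1 / 2) ^ n) ?_).mono Subset.rfl (by linarith)
    (by rw [mul_pow]; exact Nat.mul_le_mul_right _ hFc)
  intro x hx
  obtain ⟨t, ht, hxt⟩ := mem_iUnion₂.1 hx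
  obtain ⟨b, hb, rfl⟩ := hA.exists_eq hU hAB (by linarith : 0 ≤ n * τ) hxt
  obtain ⟨σ, hσ, hd⟩ := hF (θ (t - n * τ) g)
    ⟨t - n * τ, mem_Iic.2 (by have := mem_Iic.1 ht; linarith), rfl⟩
  refine ⟨U σ (n * τ) 0 b, mem_iUnion₂.2 ⟨σ, hσ, mem_image_of_mem _ hb⟩, ?_⟩
  rw [dist_eq_norm]
  refine (hUL _ hnτ _ (orbit_mem_hull θ g _) σ (hFh σ hσ) b hb).trans (le_trans ?_ hgrow)
  have := (hL _ hnτ).1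
  gcongr
  linarith

/-- Unit time windows: the sections of the attractor are covered uniformly in time, and Hölder
continuity in space and time carries these coverings over to a whole unit interval. -/
lemma IsPullbackAttractor.exists_coverableBy_Icc (hA : IsPullbackAttractor (U g) A)
    (hU : IsProcessSystem θ (hull θ g) U) (hAB : ∀ t, A t ⊆ B) {τ R : ℝ} {N : ℕ} (hτ : 0 ≤ τ)
    (hR : 0 < R)
    (hcov : ∀ σ ∈ hull θ g, ∀ n : ℕ,
      CoverableBy (U σ (n * τ) 0 '' B) (R * (1 / 2) ^ n) (N ^ n))
    {γ δ : ℝ} (hγ : 0 < γ) (hδ : 0 < δ) (hholder : IsHolderOn (hull θ g) U B γ δ) :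
    ∃ (K : ℝ) (M : ℕ), 0 < K ∧ ∀ (n : ℕ) (s : ℝ),
      CoverableBy (⋃ t ∈ Icc s (s + 1), A t) (K * (1 / 2) ^ n) (M ^ n) := by
  classical
  obtain ⟨C, hC⟩ := hholder 1 zero_le_one
  obtain ⟨a, ha⟩ := exists_nat_ge (1 / γ)
  obtain ⟨e, he⟩ := exists_nat_ge (1 / δ)
  have haγ : 1 ≤ a * γ := (div_le_iff₀ hγ).1 ha
  have heδ : 1 ≤ e * δ := (div_le_iff₀ hδ).1 he
  have hhalf : ∀ (m n : ℕ) (α : ℝ), 1 ≤ m * α →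
      (((1 / 2 : ℝ) ^ (m * n)) ^ α) ≤ (1 / 2) ^ n := by
    intro m n α hm
    rw [← Real.rpow_natCast_mul (by norm_num), ← Real.rpow_natCast]
    refine Real.rpow_le_rpow_of_exponent_ge (by norm_num) (by norm_num) ?_
    push_cast
    nlinarith [(Nat.cast_nonneg n : (0 : ℝ) ≤ n)]
  -- The exponents `a` and `e` compensate the Hölder exponents; `C` itself might be negative.
  set D : ℝ := max C 0
  refine ⟨D * ((2 * R) ^ γ + 1) + 1, N ^ a * 2 ^ e, by positivity, fun n s => ?_⟩
  have hsec : CoverableBy (A s) (R * (1 / 2) ^ (a * n)) (N ^ (a * n)) := by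
    refine (hcov _ (orbit_mem_hull θ g (s - (a * n : ℕ) * τ)) (a * n)).mono
      (fun x hx => ?_) le_rfl le_rfl
    obtain ⟨b, hb, rfl⟩ := hA.exists_eq hU hAB (by positivity : 0 ≤ (a * n : ℕ) * τ) hx
    exact mem_image_of_mem _ hb
  obtain ⟨F, hFA, hF, hFc⟩ := hsec.exists_centers_mem
  -- The time grid has mesh `2 ^ (-e n)`.
  refine ⟨(F ×ˢ Finset.range (2 ^ (e * n))).image
    fun z => U g ((z.2 : ℝ) / 2 ^ (e * n) + s) s z.1, fun x hx => ?_,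
    Finset.card_image_le.trans ?_⟩
  · obtain ⟨t, ht, hxt⟩ := mem_iUnion₂.1 hx
    rw [← hA.invariant t s ht.1] at hxt
    obtain ⟨y, hy, rfl⟩ := hxt
    obtain ⟨z, hz, hyz⟩ := hF y hy
    obtain ⟨j, hj, hj1, hjt⟩ : ∃ j ∈ Finset.range (2 ^ (e * n)),
        (j : ℝ) / 2 ^ (e * n) ∈ Icc (0 : ℝ) 1 ∧
        |(t - s) - (j : ℝ) / 2 ^ (e * n)| ≤ (1 / 2) ^ (e * n) := by
      have ht0 : 0 ≤ t - s := by linarith [ht.1]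
      have ht1 : t - s ≤ 1 := by linarith [ht.2]
      exact exists_dyadic_near ht0 ht1 (e * n)
    refine ⟨_, Finset.mem_image_of_mem _
      (Finset.mem_product.2 ⟨hz, hj⟩ : (z, j) ∈ F ×ˢ Finset.range (2 ^ (e * n))), ?_⟩
    have h := hC g (self_mem_hull θ g) s y (hAB s hy) z (hAB s (hFA z hz)) (t - s)
      ⟨by linarith [ht.1], by linarith [ht.2]⟩ _ hj1
    rw [sub_add_cancel] at h
    rw [dist_eq_norm]
    have hspace : ‖y - z‖ ^ γ ≤ (2 * R) ^ γ * (1 / 2) ^ n := by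
      rw [dist_eq_norm] at hyz
      calc ‖y - z‖ ^ γ ≤ (2 * R * (1 / 2) ^ (a * n)) ^ γ :=
            Real.rpow_le_rpow (norm_nonneg _) (by linarith) hγ.le
        _ = (2 * R) ^ γ * ((1 / 2) ^ (a * n)) ^ γ :=
            Real.mul_rpow (by positivity) (by positivity)
        _ ≤ _ := by gcongr; exact hhalf a n γ haγ
    have htime : |(t - s) - (j : ℝ) / 2 ^ (e * n)| ^ δ ≤ (1 / 2) ^ n :=
      (Real.rpow_le_rpow (abs_nonneg _) hjt hδ.le).trans (hhalf e n δ heδ)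
    have hpow : (0 : ℝ) < (1 / 2) ^ n := by positivity
    calc _ ≤ C * (‖y - z‖ ^ γ + |(t - s) - (j : ℝ) / 2 ^ (e * n)| ^ δ) := h
      _ ≤ D * ((2 * R) ^ γ * (1 / 2) ^ n + (1 / 2) ^ n) := by
          gcongr
          exact le_max_left _ _
      _ < _ := by linarith
  · rw [Finset.card_product, Finset.card_range, mul_pow, ← pow_mul, ← pow_mul]
    exact Nat.mul_le_mul_right _ hFc

end Attractor

/-- The number of unit windows needed to reach `T` from `-p n` grows linearly in `n`, so adding them
to the far past keeps the cardinality of the coverings geometric. -/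
lemma boxDim_iUnion_Iic_lt_top {X : Type*} [PseudoMetricSpace X] {A : ℝ → Set X}
    {K K' : ℝ} {M M' p : ℕ} (hK : 0 < K)
    (hpast : ∀ᶠ n : ℕ in atTop,
      CoverableBy (⋃ t ∈ Iic (-(p * n : ℝ)), A t) (K * (1 / 2) ^ n) (M ^ n))
    (hwin : ∀ (n : ℕ) (s : ℝ),
      CoverableBy (⋃ t ∈ Icc s (s + 1), A t) (K' * (1 / 2) ^ n) (M' ^ n)) (T : ℝ) :
    boxDim (⋃ t ∈ Iic T, A t) < ⊤ := by
  obtain ⟨m, hm⟩ := exists_nat_ge T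
  refine boxDim_lt_top_of_coverableBy (K := max K K') (M := M + 2 ^ (p + m + 1) * M')
    (lt_max_of_lt_left hK) ?_
  filter_upwards [hpast, eventually_ge_atTop 1] with n hn hn1
  have hwins := CoverableBy.biUnion (Finset.range (p * n + m + 1))
    fun k _ => hwin n (-(p * n : ℝ) + k)
  have hpow : (0 : ℝ) < (1 / 2) ^ n := by positivity
  refine ((hn.mono Subset.rfl (r' := max K K' * (1 / 2) ^ n) (by gcongr; exact le_max_left _ _)
    le_rfl).union (hwins.mono Subset.rfl (r' := max K K' * (1 / 2) ^ n)
    (by gcongr; exact le_max_right _ _) le_rfl)).mono ?_ le_rfl ?_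
  · intro x hx
    obtain ⟨t, ht, hxt⟩ := mem_iUnion₂.1 hx
    rcases le_or_gt t (-(p * n : ℝ)) with h | h
    · exact Or.inl (mem_iUnion₂.2 ⟨t, h, hxt⟩)
    · have h0 : 0 ≤ t + p * n := by linarith
      refine Or.inr (mem_iUnion₂.2 ⟨⌊t + p * n⌋₊, ?_, mem_iUnion₂.2 ⟨t, ⟨?_, ?_⟩, hxt⟩⟩)
      · rw [Finset.mem_range, Nat.floor_lt h0]
        push_cast
        linarith [mem_Iic.1 ht]
      · linarith [Nat.floor_le h0]
      · linarith [Nat.lt_floor_add_one (t + p * n)]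
  · rw [Finset.card_range]
    have h1 : p * n + m + 1 ≤ (2 ^ (p + m + 1)) ^ n := by
      rw [← pow_mul]
      refine le_trans ?_ Nat.lt_two_pow_self.le
      nlinarith
    calc M ^ n + (p * n + m + 1) * M' ^ n ≤ M ^ n + (2 ^ (p + m + 1) * M') ^ n := by
          rw [mul_pow]; gcongr
      _ ≤ _ := pow_add_pow_le (Nat.zero_le _) (Nat.zero_le _) (by omega)

/-! ### Existence and finite dimension of the pullback attractor -/

theorem mainTheorem6 {X Y Ξ : Type*}
    [NormedAddCommGroup X] [NormedSpace ℝ X] [CompleteSpace X]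
    [NormedAddCommGroup Y] [NormedSpace ℝ Y] [CompleteSpace Y]
    [MetricSpace Ξ] [CompleteSpace Ξ]
    (θ : Flow ℝ Ξ) (g : Ξ) (U : Ξ → ℝ → ℝ → X → X)
    (hU : IsProcessSystem θ (hull θ g) U)
    (B : Set X) (hB_closed : IsClosed B) (hB_bdd : Bornology.IsBounded B)
    (hB_abs : IsUniformlyAbsorbing (hull θ g) U B)
    (ι : Y →L[ℝ] X) (hι_inj : Function.Injective ι) (hι_compact : IsCompactOperator ι)
    (hsmooth : IsUniformlySmoothing ι (hull θ g) U B)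
    (γ δ : ℝ) (hγ : 0 < γ) (hδ : 0 < δ) (hholder : IsHolderOn (hull θ g) U B γ δ)
    (hdriving : IsLipschitzDriving θ)
    (hsymbol : IsSymbolLipschitz (hull θ g) U B)
    (Sm : Set Ξ) (hSm_compact : IsCompact Sm) (hSm_inv : ∀ t : ℝ, θ t '' Sm = Sm)
    (hSm_dim : boxDim Sm < ⊤) (hSm_alpha : alphaLimitSet θ g ⊆ Sm)
    (C η₁ : ℝ) (hC : 1 ≤ C) (hη₁ : 0 < η₁)
    (hSm_attr : ∀ t : ℝ, Metric.infEDist (θ t g) Sm ≤ ENNReal.ofReal (C * Real.exp (η₁ * t))) :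
    (∃ A : ℝ → Set X, IsPullbackAttractor (U g) A) ∧
    ∀ A : ℝ → Set X, IsPullbackAttractor (U g) A →
      ∀ T : ℝ, boxDim (⋃ t ∈ Iic T, A t) < ⊤ := by
  refine ⟨?_, fun A hA T => ?_⟩
  · refine (hU.isEvolutionProcess g (self_mem_hull θ g)).exists_isPullbackAttractor hB_closed
      hB_bdd (fun D hD => ?_) fun t => ?_
    · obtain ⟨tD, -, h⟩ := hU.exists_mapsTo hB_abs D hD
      exact ⟨tD, h⟩
    · obtain rfl | ⟨y, hy⟩ := B.eq_empty_or_nonempty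
      · exact ⟨∅, isCompact_empty, mapsTo_empty _ _⟩
      obtain ⟨κ, hκ⟩ := hsmooth 1 one_pos
      obtain ⟨R, hR⟩ := (Metric.isBounded_iff_subset_closedBall y).1 hB_bdd
      have hσ := orbit_mem_hull θ g (t - 1)
      -- `U(t, t - 1) B` lies in a translate of the compact closure of a ball of `Y`.
      refine ⟨(fun z => U g t (t - 1) y + z) '' closure (ι '' Metric.closedBall 0 (|κ| * R)),
        (IsCompactOperator.isCompact_closure_image_closedBall (f := ι.toLinearMap) hι_compact
          _).image (by fun_prop), fun x hx => ?_⟩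
      obtain ⟨w, hw, hwn⟩ := hκ _ hσ x hx y hy
      have heq : ∀ z, U g t (t - 1) z = U (θ (t - 1) g) 1 0 z := fun z => by
        rw [hU.eq_translate (self_mem_hull θ g) (by linarith), sub_sub_cancel]
      refine ⟨ι w, subset_closure (mem_image_of_mem _ (mem_closedBall_zero_iff.2 ?_)), ?_⟩
      · have hxy := hR hx
        rw [mem_closedBall_iff_norm] at hxy
        exact hwn.trans (mul_le_mul (le_abs_self κ) hxy (norm_nonneg _) (abs_nonneg κ))
      · simp only [heq, hw]
        abel
  · obtain ⟨tB, htB0, htB⟩ := hB_abs B hB_bdd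
    have hτ : 1 ≤ tB + 1 := by linarith
    have hAB := hA.subset_absorbing hU hB_abs
    obtain ⟨R, N, hR, hcov⟩ := hU.exists_coverableBy_image hB_bdd hι_compact hsmooth
      (by linarith : 0 < tB + 1) fun σ hσ t ht x hx => htB σ hσ t (by linarith) x hx
    obtain ⟨K, M, p, hK, hpast⟩ :=
      hA.exists_coverableBy_past hU hAB hτ hR hcov hsymbol hSm_dim hC hη₁ hSm_attr
    obtain ⟨K', M', -, hwin⟩ :=
      hA.exists_coverableBy_Icc hU hAB (by linarith) hR hcov hγ hδ hholder
    exact boxDim_iUnion_Iic_lt_top hK hpast hwin T
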